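/- **Setting.** Let $\mathcal X$ be a non-empty finite totally ordered universe and $X=(x_1,\dots,x_n)\in\mathcal X^n$ a stream, with prefixes $X[1:s]=(x_1,\dots,x_s)$. For a data set $Y$ of size $m$ let $r_{\min}(x)=|\{y\in Y:y<x\}|$ and $r_{\max}(x)=|\{y\in Y:y\le x\}|$; $x\in\mathcal X$ is an *$\alpha$-approximate $q$-quantile* of $Y$ if $[r_{\min}(x),r_{\max}(x)]\cap[\lceil qm\rceil-\alpha m,\lceil qm\rceil+\alpha m]\neq\emptyset$. Two streams of length $n$ are *neighbours* if they differ in at most one position, and a randomized mechanism $M$ is *$\varepsilon$-DP* if $P[M(X)\in S]\le e^{\varepsilon}P[M(X')\in S]$ for all neighbours $X,X'$ and all sets $S$ of outputs. Logarithms are natural. **DPExpGK.** Given the Greenwald–Khanna sketch $(v_i,g_i,\Delta_i)_i$ of precision $a$ of a data set of size $m$ and a budget $\varepsilon'$, put $\hat r_{\min}(x)=\max\{\sum_{j\le i}g_j: v_i<x\}$ ($0$ if there is no such $i$) and let $\hat r_{\max}(x)$ be the minimum of $m+1$ and of all $\Delta_i+\sum_{j\le i}g_j$ with $v_i>x$.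 Let $u(x)$ be minus the distance of $\lceil qm\rceil$ to $[\hat r_{\min}(x),\hat r_{\max}(x)]$. DPExpGK outputs $x\in\mathcal X$ with probability proportional to $\exp\!\big(\frac{\varepsilon'}{2(4am+2)}u(x)\big)$. The sketch is the standard one. A new minimum or maximum is inserted as $(x,1,0)$, any other item as $(x,1,\lfloor 2am\rfloor)$ after all tuples of value $\le x$, where $m$ is the number of earlier items. Before every $\lceil 1/(2a)\rceil$-th insertion the sketch is compressed: from right to left, a tuple $t_i$ other than the first is merged, together with its descendants in the band tree, into $t_{i+1}$ if $\mathrm{band}(t_i)\le\mathrm{band}(t_{i+1})$ and $g_i^*+g_{i+1}+\Delta_{i+1}<2am$, where $g_i^*$ is the sum of the $g$-values of $t_i$ and its descendants. **Algorithm CO** with constants $c,b,C>0$, on input $X$, $\alpha$, $\varepsilon$, $\beta$, $q$. Put $$\varepsilon^*=\frac{c\,\alpha\varepsilon}{\log n},\qquad \beta^*=\frac{b\,\alpha\beta}{\log n},\qquad a=\frac{(\alpha/2)\min(\varepsilon^*,1)}{24\log(|\mathcal X|/\beta^*)},\qquad n_{\min}=\frac{C}{\varepsilon\alpha^2}\,\log^2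 n\,\log\frac{|\mathcal X|\log n}{\alpha\beta}.$$ Start with an empty sketch of precision $a$, $v_0=\bot$ and $\mathrm{cp}(0)=n_{\min}$. At step $s=1,\dots,n$ insert $x_s$ into the sketch. If $s=\lceil\mathrm{cp}(s-1)\rceil$, release a new value: $v_s$ is the output of DPExpGK on the current sketch with budget $\varepsilon^*$ and fresh randomness, and $\mathrm{cp}(s)=(1+\alpha/2)\,\mathrm{cp}(s-1)$. Otherwise $v_s=v_{s-1}$ and $\mathrm{cp}(s)=\mathrm{cp}(s-1)$. The output is $(v_1,\dots,v_n)$. **Theorem.** There are absolute constants $c,b,C,K>0$ such that for every non-empty finite totally ordered $\mathcal X$, every $n\ge3$, $\alpha\in(0,1]$, $\varepsilon>0$, $q\in[0,1]$ and $\beta\in(0,1]$: 1. Algorithm CO, as a mechanism on $\mathcal X^n$ with output $(v_1,\dots,v_n)$, is $\varepsilon$-DP. 2. It releases a new value at no more than $K\,\frac{\log n}{\alpha}$ positions $s\in\{1,\dots,n\}$. 3. If $\alpha\varepsilon\le\log n$, then for every stream $X\in\mathcal X^n$, with probability at least $1-\beta$, simultaneously for all positions $1\le s\le n$ with $$s\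 \ge\ n_{\min}=\frac{C}{\varepsilon\alpha^2}\,\log^2 n\,\log\frac{|\mathcal X|\log n}{\alpha\beta},$$ the value $v_s$ is an $\alpha$-approximate $q$-quantile of $X[1:s]$. -/

import Mathlib

namespace DPQuantile

/-! ### Ranks and approximate quantiles -/

section Quantiles

variable {X : Type*} [LinearOrder X]

/-- Number of stream items strictly below `x`. -/
def rMin (l : List X) (x : X) : ℕ := l.countP (fun y => decide (y < x))

/-- Number of stream items at most `x`. -/
def rMax (l : List X) (x : X) : ℕ := l.countP (fun y => decide (y ≤ x))

/-- `x` is an `α`-approximate `q`-quantile of the data set `l`: its rank interval meets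
`[⌈q n⌉ - α n, ⌈q n⌉ + α n]`, where `n` is the size of `l`. -/
def IsApproxQuantile (α q : ℝ) (l : List X) (x : X) : Prop :=
  (Set.Icc (rMin l x : ℝ) (rMax l x : ℝ) ∩
    Set.Icc ((⌈q * (l.length : ℝ)⌉₊ : ℝ) - α * (l.length : ℝ))
      ((⌈q * (l.length : ℝ)⌉₊ : ℝ) + α * (l.length : ℝ))).Nonempty

end Quantiles

/-! ### Differential privacy -/

/-- Two streams of the same length are neighbours if they differ in at most one position. -/
def Neighbors {X : Type*} {n : ℕ} (x y : Fin n → X) : Prop :=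
  ∃ i : Fin n, ∀ j : Fin n, j ≠ i → x j = y j

/-- `(ε, δ)`-differential privacy of a randomized mechanism. -/
def IsDP {X R : Type*} {n : ℕ} (ε δ : ℝ) (M : (Fin n → X) → PMF R) : Prop :=
  ∀ x y : Fin n → X, Neighbors x y → ∀ S : Set R,
    (M x).toOuterMeasure S ≤
      ENNReal.ofReal (Real.exp ε) * (M y).toOuterMeasure S + ENNReal.ofReal δ

/-! ### The Greenwald-Khanna sketch -/

/-- A tuple `(v, g, Δ)` of the sketch. -/
structure GKTuple (X : Type*) where
  v : X
  g : ℕ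
  Δ : ℕ

/-- The Greenwald-Khanna band of `Δ` relative to `p = ⌊2 a n⌋`: band `0` is `{p}`, and band `k ≥ 1`
consists of the `Δ` with `p - 2^k - (p mod 2^k) < Δ ≤ p - 2^(k-1) - (p mod 2^(k-1))`. These ranges
are adjacent, so the band is the least `k` that satisfies the lower bound. The value `Δ = 0` is the
only member of the highest band. -/
noncomputable def band (p Δ : ℕ) : ℕ := sInf {k : ℕ | p < Δ + 2 ^ k + p % 2 ^ k}

section GK

variable {X : Type*}

/-- The right-to-left pass of the compress operation. The list is read from the largest tuple to the
smallest; `cur` is the current right neighbour `t_{i+1}` and `t` is `t_i`. In the tree in which the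
parent of a tuple is the next tuple to its right of strictly larger band, the descendants of `t` are
exactly the maximal run of tuples immediately to its left of band smaller than that of `t`. If
`band t ≤ band cur` and the merged tuple stays below capacity `2 a n`, then `t` and its
descendants are merged into `cur`. -/
noncomputable def gkMergePass (a : ℝ) (n : ℕ) (cur : GKTuple X) : List (GKTuple X) → List (GKTuple X)
  | [] => [cur]
  | t :: rest =>
    let p := ⌊2 * a * (n : ℝ)⌋₊
    let isDesc : GKTuple X → Bool := fun d => decide (band p d.Δ < band p t.Δ)
    let gStar := t.g + ((rest.takeWhile isDesc).map GKTuple.g).sum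
    if band p t.Δ ≤ band p cur.Δ ∧ ((gStar + cur.g + cur.Δ : ℕ) : ℝ) < 2 * a * (n : ℝ) then
      gkMergePass a n ⟨cur.v, gStar + cur.g, cur.Δ⟩ (rest.dropWhile isDesc)
    else
      cur :: gkMergePass a n t rest
termination_by l => l.length
decreasing_by
  · exact Nat.lt_succ_of_le (List.length_dropWhile_le _ _)
  · exact Nat.lt_succ_self _

/-- Compress. The first tuple (the minimum of the stream) is always kept. -/
noncomputable def gkCompress (a : ℝ) (n : ℕ) (S : List (GKTuple X)) : List (GKTuple X) :=
  if (n : ℝ) < 1 / (2 * a) then S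
  else
    match S with
    | [] => []
    | t₀ :: tail =>
      match tail.reverse with
      | [] => [t₀]
      | last :: rest => t₀ :: (gkMergePass a n last rest).reverse

variable [LinearOrder X]

/-- Insert `x` into the (sorted) sketch of a stream of `n` items, after all tuples with value at most
`x`. A new minimum or maximum gets `Δ = 0`, any other item gets `Δ = ⌊2 a n⌋`. -/
noncomputable def gkInsert (a : ℝ) (n : ℕ) (S : List (GKTuple X)) (x : X) : List (GKTuple X) :=
  let lo := S.takeWhile (fun t => decide (t.v ≤ x))
  let hi := S.dropWhile (fun t => decide (t.v ≤ x))
  lo ++ ⟨x, 1, if lo.isEmpty || hi.isEmpty then 0 else ⌊2 * a * (n : ℝ)⌋₊⟩ :: hi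

/-- Process item number `n + 1`, whose value is `x`: compress when `n + 1` is a multiple of the
(rounded) period `1 / (2 a)`, then insert. -/
noncomputable def gkStep (a : ℝ) (n : ℕ) (S : List (GKTuple X)) (x : X) : List (GKTuple X) :=
  gkInsert a n (if ⌈1 / (2 * a)⌉₊ ∣ n + 1 then gkCompress a n S else S) x

/-! ### The mechanism DPExpGK -/

/-- The lower rank bound `∑_{j ≤ i} g_j` of the `i`-th tuple. -/
def gSum (S : List (GKTuple X)) (i : ℕ) : ℕ := ((S.take (i + 1)).map GKTuple.g).sum

/-- `max {∑_{j ≤ i} g_j : v_i < x}`, including the formal tuple at `-∞` of rank `0`. -/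
def rHatMin (S : List (GKTuple X)) (x : X) : ℕ :=
  (Finset.univ.filter (fun i : Fin S.length => (S.get i).v < x)).fold max 0
    (fun i : Fin S.length => gSum S (i : ℕ))

/-- `min {Δ_i + ∑_{j ≤ i} g_j : v_i > x}`, including the formal tuple at `∞` of rank `n + 1`. -/
def rHatMax (n : ℕ) (S : List (GKTuple X)) (x : X) : ℕ :=
  (Finset.univ.filter (fun i : Fin S.length => x < (S.get i).v)).fold min (n + 1)
    (fun i : Fin S.length => (S.get i).Δ + gSum S (i : ℕ))

/-- The score of `x`: minus the distance of `⌈q n⌉` to the interval `[rHatMin x, rHatMax x]`. -/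
noncomputable def score (q : ℝ) (n : ℕ) (S : List (GKTuple X)) (x : X) : ℝ :=
  -max 0 (max ((rHatMin S x : ℝ) - (⌈q * (n : ℝ)⌉₊ : ℝ)) ((⌈q * (n : ℝ)⌉₊ : ℝ) - (rHatMax n S x : ℝ)))

/-- Weight of `x` in the exponential mechanism: `exp (ε u(x) / (2 Δ_u))` with the sensitivity bound
`Δ_u = 4 a n + 2` of the score. -/
noncomputable def expWeight (a ε q : ℝ) (n : ℕ) (S : List (GKTuple X)) (x : X) : ENNReal :=
  ENNReal.ofReal (Real.exp (ε / (2 * (4 * a * (n : ℝ) + 2)) * score q n S x))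

/-- DPExpGK on a sketch `S` (of precision `a`) of `n` items: output `x` with probability
proportional to `expWeight x`. -/
noncomputable def dpExpGK [Fintype X] [Nonempty X] (a ε q : ℝ) (n : ℕ) (S : List (GKTuple X)) :
    PMF X :=
  PMF.normalize (expWeight a ε q n S)
    (by
      obtain ⟨x⟩ := ‹Nonempty X›
      intro h
      have := ENNReal.tsum_eq_zero.mp h x
      simp only [expWeight, ENNReal.ofReal_eq_zero] at this
      exact absurd (Real.exp_pos _) (not_lt.mpr this))
    (by
      rw [tsum_fintype]
      exact ENNReal.sum_ne_top.mpr (fun _ _ => ENNReal.ofReal_ne_top))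

end GK

/-! ### The continual-observation algorithm -/

/-- Privacy budget `ε* = c α ε / log n` of one release. -/
noncomputable def epsStar (c : ℝ) (n : ℕ) (α ε : ℝ) : ℝ := c * (α * ε / Real.log n)

/-- Failure probability `β* = b α β / log n` of one release. -/
noncomputable def betaStar (b : ℝ) (n : ℕ) (α β : ℝ) : ℝ := b * (α * β / Real.log n)

/-- Precision of the sketch that DPExpGK needs for target accuracy `α`, budget `ε`, failure
probability `β`: `α min(ε, 1) / (24 log(|X| / β))`. -/
noncomputable def sketchPrecision (N : ℕ) (α ε β : ℝ) : ℝ :=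
  α * min ε 1 / (24 * Real.log ((N : ℝ) / β))

/-- `C / (ε α²) · log² n · log(|X| log n / (α β))`. -/
noncomputable def nMin (C : ℝ) (N n : ℕ) (α ε β : ℝ) : ℝ :=
  C * (1 / (ε * α ^ 2) * Real.log n ^ 2 * Real.log ((N : ℝ) * Real.log n / (α * β)))

/-- The checkpoint variable `cp(s)`, started at `m`: multiplied by `1 + α / 2` at each release. -/
noncomputable def cp (m α : ℝ) : ℕ → ℝ
  | 0 => m
  | s + 1 => if s + 1 = ⌈cp m α s⌉₊ then cp m α s * (1 + α / 2) else cp m α s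

/-- The positions in `{1, …, n}` at which a new value is released. -/
noncomputable def releaseTimes (m α : ℝ) (n : ℕ) : Finset ℕ :=
  (Finset.Icc 1 n).filter (fun s => s = ⌈cp m α (s - 1)⌉₊)

section CO

variable {X : Type*} [LinearOrder X] [Fintype X] [Nonempty X]

/-- The main loop after `s` items, with sketch `S` and current value `v`, on the remaining items: the
joint law of all later values `v_{s+1}, v_{s+2}, …`. Here `m` is the first checkpoint, `a` the
sketch precision, `e` the budget of one release. `none` stands for `⊥`. -/
noncomputable def coLoop (m α a e q : ℝ) :
    List X → ℕ → List (GKTuple X) → Option X → PMF (List (Option X))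
  | [], _, _, _ => PMF.pure []
  | x :: xs, s, S, v =>
    let S' := gkStep a s S x
    if s + 1 = ⌈cp m α s⌉₊ then
      (dpExpGK a e q (s + 1) S').bind fun y =>
        (coLoop m α a e q xs (s + 1) S' (some y)).map (fun out => some y :: out)
    else
      (coLoop m α a e q xs (s + 1) S' v).map (fun out => v :: out)

/-- The continual-observation algorithm on a stream of length `n`, with the constants `c` (budget),
`b` (failure probability) and `C` (first checkpoint): the law of `[v_1, …, v_n]`. -/
noncomputable def continualQuantile (c b C : ℝ) {n : ℕ} (α ε β q : ℝ) (x : Fin n → X) :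
    PMF (List (Option X)) :=
  coLoop (nMin C (Fintype.card X) n α ε β) α
    (sketchPrecision (Fintype.card X) (α / 2) (epsStar c n α ε) (betaStar b n α β))
    (epsStar c n α ε) q (List.ofFn x) 0 [] none

end CO

end DPQuantile

/-! Privacy and accuracy rest on one deterministic fact: for every list of tuples satisfying
`IsSketch`, `rHatMin` and `rHatMax` are within `2am + 1` of the true ranks. Sketches of neighbouring
streams may look entirely different, but true ranks change by at most one, so the score moves by at
most `4am + 2` (`score_le_score_add`) and one release is private (`dpExpGK_le`). The band rule plays
no role in this; only the capacity test of a merge does.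

Checkpoints grow by the factor `1 + α/2` and depend on positions alone, so there are at most `5 log
n / α` releases (`releaseTimes_card_le`). Composition over them gives `ε` (`coLoop_le`), a union
bound gives `β` (`coLoop_wrongOutputs_le`).

A release at time `t` has rank error at most `αt/2`, except with probability `β*`
(`dpExpGK_not_rankErrorLE_le`). Before the next one fewer than `αt/2` items arrive, and each adds at
most one to the error (`RankErrorLE.append`), so the value stays `α`-accurate. -/

namespace DPQuantile

/-! ### Rank invariants of the sketch -/

section GKInvariant

variable {X : Type*}

/-- Total weight of a list of tuples. -/
def gTotal (S : List (GKTuple X)) : ℕ := (S.map GKTuple.g).sum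

@[simp] lemma gTotal_nil : gTotal ([] : List (GKTuple X)) = 0 := rfl

@[simp] lemma gTotal_cons (t : GKTuple X) (S : List (GKTuple X)) :
    gTotal (t :: S) = t.g + gTotal S := by simp [gTotal]

@[simp] lemma gTotal_append (S T : List (GKTuple X)) :
    gTotal (S ++ T) = gTotal S + gTotal T := by simp [gTotal]

@[simp] lemma gTotal_reverse (S : List (GKTuple X)) : gTotal S.reverse = gTotal S := by
  simp [gTotal]

lemma gSum_append_cons (A : List (GKTuple X)) (t : GKTuple X) (T : List (GKTuple X)) :
    gSum (A ++ t :: T) A.length = gTotal A + t.g := by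
  have : (A.map GKTuple.g).take (A.length + 1) = A.map GKTuple.g :=
    List.take_of_length_le (by simp)
  simp [gSum, gTotal, List.take_append, this]

lemma gkMergePass_gTotal (a : ℝ) (n : ℕ) (cur : GKTuple X) (L : List (GKTuple X)) :
    gTotal (gkMergePass a n cur L) = gTotal (cur :: L) := by
  fun_induction gkMergePass a n cur L with
  | case1 => simp
  | case2 cur t rest p isDesc gStar h ih =>
    rw [ih]
    conv_rhs => rw [← List.takeWhile_append_dropWhile (p := isDesc) (l := rest)]
    have hg : gStar = t.g + gTotal (rest.takeWhile isDesc) := rfl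
    simp only [gTotal_cons, gTotal_append, hg]
    ring
  | case3 cur t rest p isDesc gStar h ih =>
    simp only [gTotal_cons] at ih ⊢
    rw [ih]

lemma gkMergePass_sublist (a : ℝ) (n : ℕ) (cur : GKTuple X) (L : List (GKTuple X)) :
    ((gkMergePass a n cur L).map GKTuple.v).Sublist ((cur :: L).map GKTuple.v) := by
  fun_induction gkMergePass a n cur L with
  | case1 => simp
  | case2 cur t rest p isDesc gStar h ih =>
    refine ih.trans ?_
    simp only [List.map_cons, List.cons_sublist_cons]
    exact ((List.dropWhile_sublist _).map _).trans (List.sublist_cons_self _ _)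
  | case3 cur t rest p isDesc gStar h ih =>
    simpa using ih

variable [LinearOrder X]

lemma rMin_append_singleton (l : List X) (x v : X) :
    rMin (l ++ [x]) v = rMin l v + if x < v then 1 else 0 := by
  simp [rMin, List.countP_append, List.countP_cons]

lemma rMax_append_singleton (l : List X) (x v : X) :
    rMax (l ++ [x]) v = rMax l v + if x ≤ v then 1 else 0 := by
  simp [rMax, List.countP_append, List.countP_cons]

lemma rMin_mono (l : List X) {x y : X} (h : x ≤ y) : rMin l x ≤ rMin l y :=
  List.countP_mono_left fun _ _ hz => by
    simp only [decide_eq_true_eq] at hz ⊢; exact hz.trans_le h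

lemma rMax_mono (l : List X) {x y : X} (h : x ≤ y) : rMax l x ≤ rMax l y :=
  List.countP_mono_left fun _ _ hz => by
    simp only [decide_eq_true_eq] at hz ⊢; exact hz.trans h

lemma rMin_le_rMax (l : List X) (x : X) : rMin l x ≤ rMax l x :=
  List.countP_mono_left fun _ _ hz => by
    simp only [decide_eq_true_eq] at hz ⊢; exact hz.le

lemma rMax_le_rMin (l : List X) {x y : X} (h : x < y) : rMax l x ≤ rMin l y :=
  List.countP_mono_left fun _ _ hz => by
    simp only [decide_eq_true_eq] at hz ⊢; exact hz.trans_lt h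

lemma rMin_le_length (l : List X) (x : X) : rMin l x ≤ l.length := List.countP_le_length

lemma rMax_le_length (l : List X) (x : X) : rMax l x ≤ l.length := List.countP_le_length

/-- A segment of tuples preceded by total weight `r` has correct rank bounds for the data `l`, and
every tuple has uncertainty at most `B`. -/
def RankBounds (l : List X) (B : ℕ) : ℕ → List (GKTuple X) → Prop
  | _, [] => True
  | r, t :: ts => (r + t.g ≤ rMax l t.v ∧ rMin l t.v + 1 ≤ r + t.g + t.Δ ∧ t.g + t.Δ ≤ B) ∧
      RankBounds l B (r + t.g) ts

lemma rankBounds_append (l : List X) (B : ℕ) (S T : List (GKTuple X)) (r : ℕ) :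
    RankBounds l B r (S ++ T) ↔ RankBounds l B r S ∧ RankBounds l B (r + gTotal S) T := by
  induction S generalizing r with
  | nil => simp [RankBounds]
  | cons t S ih => simp [RankBounds, ih, and_assoc, add_assoc]

lemma RankBounds.mono {l : List X} {B B' : ℕ} (hB : B ≤ B') {S : List (GKTuple X)} {r : ℕ}
    (h : RankBounds l B r S) : RankBounds l B' r S := by
  induction S generalizing r with
  | nil => trivial
  | cons t S ih => exact ⟨⟨h.1.1, h.1.2.1, h.1.2.2.trans hB⟩, ih h.2⟩

/-- The invariant of a sketch `S` of the data `l`, with uncertainty at most `B`. -/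
structure IsSketch (B : ℕ) (l : List X) (S : List (GKTuple X)) : Prop where
  sorted : (S.map GKTuple.v).Pairwise (· ≤ ·)
  ranks : RankBounds l B 0 S
  total : gTotal S = l.length
  -- This justifies `Δ = 0` for a new minimum, and is why compression must keep the first tuple.
  head : ∀ t ∈ S.head?, rMin l t.v = 0

/-- A merged tuple keeps the value, the `Δ` and the cumulative weight of its right neighbour, so its
two rank bounds are inherited. Only `g + Δ ≤ B` is new, and that is the capacity test. The pass
reads from right to left, hence the reversals. -/
lemma gkMergePass_rankBounds (a : ℝ) (n : ℕ) (cur : GKTuple X) (L : List (GKTuple X))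
    (l : List X) {B : ℕ} (hB : ⌊2 * a * (n : ℝ)⌋₊ ≤ B) (r : ℕ)
    (h : RankBounds l B r (cur :: L).reverse) :
    RankBounds l B r (gkMergePass a n cur L).reverse := by
  fun_induction gkMergePass a n cur L with
  | case1 => exact h
  | case2 cur t rest p isDesc gStar hc ih =>
    apply ih
    rw [← List.takeWhile_append_dropWhile (p := isDesc) (l := rest)] at h
    simp only [List.reverse_cons, List.reverse_append, rankBounds_append, RankBounds,
      gTotal_append, gTotal_cons, gTotal_nil, gTotal_reverse, and_true] at h ⊢
    have hle : gStar + cur.g + cur.Δ ≤ B := (Nat.le_floor hc.2.le).trans hB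
    obtain ⟨⟨⟨h1, -⟩, -⟩, h2, h3, -⟩ := h
    have hg : gStar = t.g + gTotal (rest.takeWhile isDesc) := rfl
    refine ⟨h1, ?_, ?_, hle⟩ <;> omega
  | case3 cur t rest p isDesc gStar hc ih =>
    rw [List.reverse_cons, rankBounds_append] at h ⊢
    refine ⟨ih h.1, ?_⟩
    simpa [gkMergePass_gTotal, add_comm, add_left_comm] using h.2

lemma IsSketch.gkCompress {a : ℝ} {n B : ℕ} {l : List X} {S : List (GKTuple X)}
    (hB : ⌊2 * a * (n : ℝ)⌋₊ ≤ B) (h : IsSketch B l S) : IsSketch B l (gkCompress a n S) := by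
  unfold DPQuantile.gkCompress
  split_ifs with hn
  · exact h
  · match S, h with
    | [], h => exact h
    | t₀ :: tail, h =>
      rcases hr : tail.reverse with _ | ⟨last, rest⟩
      · have : tail = [] := by simpa using hr
        subst this
        simpa [hr] using h
      · have ht : tail = (last :: rest).reverse := by rw [← hr, List.reverse_reverse]
        simp only [hr]
        obtain ⟨h1, h2, h3, h4⟩ := h
        subst ht
        refine ⟨?_, ⟨h2.1, gkMergePass_rankBounds a n last rest l hB _ h2.2⟩, ?_, by simpa using h4⟩
        · refine h1.sublist ?_
          rw [List.map_cons, List.map_cons, List.cons_sublist_cons, List.map_reverse,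
            List.map_reverse]
          exact (gkMergePass_sublist a n last rest).reverse
        · rw [← h3, gTotal_cons, gTotal_cons, gTotal_reverse, gkMergePass_gTotal, gTotal_reverse]

lemma RankBounds.append_of_le {l : List X} {B r : ℕ} {S : List (GKTuple X)} {x : X}
    (hx : ∀ t ∈ S, t.v ≤ x) (h : RankBounds l B r S) : RankBounds (l ++ [x]) B r S := by
  induction S generalizing r with
  | nil => trivial
  | cons t S ih =>
    have htx : ¬ x < t.v := not_lt.mpr (hx t (by simp))
    refine ⟨⟨?_, ?_, h.1.2.2⟩, ih (fun u hu => hx u (by simp [hu])) h.2⟩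
    · rw [rMax_append_singleton]; exact h.1.1.trans (Nat.le_add_right _ _)
    · rw [rMin_append_singleton, if_neg htx]; exact h.1.2.1

/-- To the right of `x` both ranks grow by one, and so does the preceding weight once the new tuple
is in place. -/
lemma RankBounds.append_of_lt {l : List X} {B r : ℕ} {S : List (GKTuple X)} {x : X}
    (hx : ∀ t ∈ S, x < t.v) (h : RankBounds l B r S) : RankBounds (l ++ [x]) B (r + 1) S := by
  induction S generalizing r with
  | nil => trivial
  | cons t S ih =>
    have htx : x < t.v := hx t (by simp)
    have := ih (fun u hu => hx u (by simp [hu])) h.2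
    refine ⟨⟨?_, ?_, h.1.2.2⟩, by rwa [add_right_comm]⟩
    · rw [rMax_append_singleton, if_pos htx.le]; have := h.1.1; omega
    · rw [rMin_append_singleton, if_pos htx]; have := h.1.2.1; omega

/-- Weight of a prefix all of whose values are at most `x`. -/
lemma RankBounds.gTotal_le_rMax {l : List X} {B : ℕ} {S : List (GKTuple X)} {x : X}
    (hx : ∀ t ∈ S, t.v ≤ x) (h : RankBounds l B 0 S) : gTotal S ≤ rMax l x := by
  rcases List.eq_nil_or_concat S with rfl | ⟨A, t, rfl⟩
  · simp
  · rw [List.concat_eq_append] at *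
    rw [rankBounds_append] at h
    have h1 := h.2.1.1
    have h2 := rMax_mono l (hx t (by simp))
    simp only [gTotal_append, gTotal_cons, gTotal_nil]
    omega

/-- With `p = ⌊2am⌋`, an interior `x` has a right neighbour `u` with `u.g + u.Δ ≤ p + 1`. Hence
`rMin x ≤ rMin u.v ≤ gTotal lo + p`, which makes `Δ = p` valid. A new minimum uses the `head` field,
a new maximum the total weight. The new tuple itself has `g + Δ ≤ p + 1`, whence the `+ 1` in the
bound. -/
lemma IsSketch.gkInsert {a : ℝ} {l : List X} {S : List (GKTuple X)} (x : X)
    (h : IsSketch (⌊2 * a * (l.length : ℝ)⌋₊ + 1) l S) :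
    IsSketch (⌊2 * a * (l.length : ℝ)⌋₊ + 1) (l ++ [x]) (gkInsert a l.length S x) := by
  unfold DPQuantile.gkInsert
  set lo := S.takeWhile (fun t => decide (t.v ≤ x)) with hlo
  set hi := S.dropWhile (fun t => decide (t.v ≤ x)) with hhi
  set p := ⌊2 * a * (l.length : ℝ)⌋₊
  have hS : S = lo ++ hi := (List.takeWhile_append_dropWhile).symm
  have hlox : ∀ t ∈ lo, t.v ≤ x := fun t ht => by simpa using List.mem_takeWhile_imp ht
  obtain ⟨h1, h2, h3, h4⟩ := h
  have hhix : ∀ t ∈ hi, x < t.v := by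
    rcases hc : hi with _ | ⟨u, us⟩
    · simp
    · have hu : x < u.v := by
        have := List.head?_dropWhile_not (fun t : GKTuple X => decide (t.v ≤ x)) S
        rw [← hhi, hc] at this
        simpa using this
      rw [hS, hc, List.map_append, List.pairwise_append, List.map_cons, List.pairwise_cons] at h1
      intro t ht
      rcases List.mem_cons.mp ht with rfl | ht
      · exact hu
      · exact hu.trans_le (h1.2.1.1 _ (List.mem_map_of_mem ht))
  clear_value lo hi
  subst hS
  rw [rankBounds_append, zero_add] at h2
  have hlomax := h2.1.gTotal_le_rMax hlox
  refine ⟨?_, ?_, ?_, ?_⟩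
  · rw [List.map_append, List.pairwise_append] at h1
    simp only [List.map_append, List.map_cons, List.pairwise_append, List.pairwise_cons]
    refine ⟨h1.1, ⟨?_, h1.2.1⟩, ?_⟩
    · simp only [List.mem_map]
      rintro _ ⟨t, ht, rfl⟩
      exact (hhix t ht).le
    · simp only [List.mem_map, List.mem_cons]
      rintro _ ⟨t, ht, rfl⟩ b (rfl | ⟨u, hu, rfl⟩)
      · exact hlox t ht
      · exact (hlox t ht).trans (hhix u hu).le
  · rw [rankBounds_append, zero_add]
    refine ⟨h2.1.append_of_le hlox, ⟨⟨?_, ?_, ?_⟩, h2.2.append_of_lt hhix⟩⟩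
    · simp only
      rw [rMax_append_singleton, if_pos le_rfl]; omega
    · simp only
      rw [rMin_append_singleton, if_neg (lt_irrefl x)]
      rcases lo with _ | ⟨t, lo⟩
      · have : rMin l x = 0 := by
          rcases hi with _ | ⟨u, us⟩
          · have : l = [] := by simpa using h3.symm
            simp [this, rMin]
          · have := rMin_mono l (hhix u (by simp)).le
            have := h4 u (by simp)
            omega
        simp [this]
      · rcases hi with _ | ⟨u, us⟩
        · have := rMin_le_length l x
          simp only [List.append_nil] at h3
          omega
        · have := rMin_mono l (hhix u (by simp)).le
          have h5 := h2.2.1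
          simp only [List.isEmpty_cons, Bool.or_self, Bool.false_eq_true, if_false]
          omega
    · simp only
      split_ifs <;> omega
  · simp only [gTotal_append, gTotal_cons, List.length_append, List.length_singleton] at h3 ⊢
    omega
  · rcases lo with _ | ⟨t, lo⟩
    · simp only [List.nil_append, List.head?_cons, Option.mem_some_iff, forall_eq']
      rw [rMin_append_singleton, if_neg (lt_irrefl x)]
      rcases hi with _ | ⟨u, us⟩
      · have : l = [] := by simpa using h3.symm
        simp [this, rMin]
      · have := rMin_mono l (hhix u (by simp)).le
        have := h4 u (by simp)
        omega
    · simp only [List.cons_append, List.head?_cons, Option.mem_some_iff, forall_eq'] at h4 ⊢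
      rw [rMin_append_singleton, if_neg (not_lt.mpr (hlox t (by simp))), h4]

lemma IsSketch.mono {B B' : ℕ} (hB : B ≤ B') {l : List X} {S : List (GKTuple X)}
    (h : IsSketch B l S) : IsSketch B' l S :=
  ⟨h.sorted, h.ranks.mono hB, h.total, h.head⟩

lemma IsSketch.nil (B : ℕ) : IsSketch B ([] : List X) [] :=
  ⟨by simp, trivial, rfl, by simp⟩

lemma IsSketch.gkStep {a : ℝ} (ha : 0 ≤ a) {l : List X} {S : List (GKTuple X)} (x : X)
    (h : IsSketch (⌊2 * a * (l.length : ℝ)⌋₊ + 1) l S) :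
    IsSketch (⌊2 * a * ((l ++ [x]).length : ℝ)⌋₊ + 1) (l ++ [x]) (gkStep a l.length S x) := by
  unfold DPQuantile.gkStep
  refine IsSketch.mono (B := ⌊2 * a * (l.length : ℝ)⌋₊ + 1) ?_ (IsSketch.gkInsert x ?_)
  · gcongr
    simp
  · split_ifs
    · exact h.gkCompress (Nat.le_succ _)
    · exact h

/-! ### Accuracy of the rank estimates -/

lemma gTotal_le_rHatMin {A T : List (GKTuple X)} {x : X} (hA : ∀ t ∈ A, t.v < x) :
    gTotal A ≤ rHatMin (A ++ T) x := by
  rcases List.eq_nil_or_concat A with rfl | ⟨A, t, rfl⟩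
  · simp
  · rw [List.concat_eq_append] at *
    unfold rHatMin
    rw [Finset.le_fold_max]
    right
    refine ⟨⟨A.length, by simp⟩, ?_, ?_⟩
    · have := hA t (by simp)
      simp [this]
    · simp only [List.append_assoc, List.singleton_append]
      rw [gSum_append_cons]
      simp

lemma rHatMax_le_of_lt {A T : List (GKTuple X)} {t : GKTuple X} {x : X} (ht : x < t.v) (n : ℕ) :
    rHatMax n (A ++ t :: T) x ≤ gTotal A + t.g + t.Δ := by
  unfold rHatMax
  rw [Finset.fold_min_le]
  right
  refine ⟨⟨A.length, by simp⟩, by simpa using ht, ?_⟩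
  simp only
  rw [gSum_append_cons]
  simp
  omega

lemma RankBounds.get {l : List X} {B : ℕ} {S : List (GKTuple X)} (h : RankBounds l B 0 S)
    (i : Fin S.length) : gSum S i ≤ rMax l (S.get i).v ∧
      rMin l (S.get i).v + 1 ≤ gSum S i + (S.get i).Δ := by
  have hS : S = S.take i ++ S.get i :: S.drop (i + 1) := by simp
  have hg : gSum S i = gTotal (S.take i) + (S.get i).g := by
    unfold gSum
    rw [List.take_succ_eq_append_getElem i.2]
    simp [gTotal]
  rw [hS, rankBounds_append, zero_add] at h
  rw [hg]
  exact ⟨h.2.1.1, h.2.1.2.1⟩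

lemma IsSketch.rHatMin_le {B : ℕ} {l : List X} {S : List (GKTuple X)} (h : IsSketch B l S) (x : X) :
    rHatMin S x ≤ rMin l x := by
  unfold rHatMin
  rw [Finset.fold_max_le]
  refine ⟨Nat.zero_le _, fun i hi => ?_⟩
  exact (h.ranks.get i).1.trans (rMax_le_rMin l (by simpa using hi))

/-- The first tuple `t` with value at least `x` has rank at least that of `x`, and its upper bound
exceeds the weight before it by `t.g + t.Δ ≤ B + 1`. Without such a tuple the weight is the whole
stream. -/
lemma IsSketch.rMin_le {B : ℕ} {l : List X} {S : List (GKTuple X)} (h : IsSketch (B + 1) l S)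
    (x : X) : rMin l x ≤ rHatMin S x + B := by
  have hS := (List.takeWhile_append_dropWhile (p := fun t : GKTuple X => decide (t.v < x))
    (l := S)).symm
  have hlo : ∀ t ∈ S.takeWhile (fun t => decide (t.v < x)), t.v < x := fun t ht => by
    simpa using List.mem_takeWhile_imp ht
  have hhi := List.head?_dropWhile_not (fun t : GKTuple X => decide (t.v < x)) S
  generalize S.takeWhile (fun t => decide (t.v < x)) = lo at *
  generalize S.dropWhile (fun t => decide (t.v < x)) = hi at *
  subst hS
  have h1 := gTotal_le_rHatMin (T := hi) hlo
  rcases hi with _ | ⟨t, hi⟩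
  · have := h.total
    have := rMin_le_length l x
    simp only [List.append_nil] at *
    omega
  · have h2 := h.ranks
    rw [rankBounds_append] at h2
    have h3 := h2.2.1
    have := rMin_mono l (x := x) (y := t.v) (by simpa using hhi)
    omega

lemma IsSketch.rMax_lt {B : ℕ} {l : List X} {S : List (GKTuple X)} (h : IsSketch B l S) (x : X) :
    rMax l x + 1 ≤ rHatMax l.length S x := by
  unfold rHatMax
  rw [Finset.le_fold_min]
  refine ⟨by have := rMax_le_length l x; omega, fun i hi => ?_⟩
  have := (h.ranks.get i).2
  have := rMax_le_rMin l (x := x) (y := (S.get i).v) (by simpa using hi)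
  omega

lemma IsSketch.rHatMax_le {B : ℕ} {l : List X} {S : List (GKTuple X)} (h : IsSketch (B + 1) l S)
    (x : X) : rHatMax l.length S x ≤ rMax l x + B + 1 := by
  have hS := (List.takeWhile_append_dropWhile (p := fun t : GKTuple X => decide (t.v ≤ x))
    (l := S)).symm
  have hlo : ∀ t ∈ S.takeWhile (fun t => decide (t.v ≤ x)), t.v ≤ x := fun t ht => by
    simpa using List.mem_takeWhile_imp ht
  have hhi := List.head?_dropWhile_not (fun t : GKTuple X => decide (t.v ≤ x)) S
  generalize S.takeWhile (fun t => decide (t.v ≤ x)) = lo at *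
  generalize S.dropWhile (fun t => decide (t.v ≤ x)) = hi at *
  subst hS
  have h2 := h.ranks
  rw [rankBounds_append] at h2
  have h1 := h2.1.gTotal_le_rMax hlo
  rcases hi with _ | ⟨t, hi⟩
  · have := h.total
    have : rHatMax l.length (lo ++ []) x ≤ l.length + 1 := by
      unfold rHatMax
      rw [Finset.fold_min_le]
      exact Or.inl le_rfl
    simp only [List.append_nil] at *
    omega
  · have h3 := h2.2.1
    have := rHatMax_le_of_lt (A := lo) (T := hi) (t := t) (x := x) (by simpa using hhi) l.length
    omega

end GKInvariant

/-! ### The exponential mechanism -/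

section ExpMech

variable {X : Type*}

/-- The data sets have counts that differ by at most one. -/
def CountClose (l l' : List X) : Prop :=
  l.length = l'.length ∧ ∀ p : X → Bool, l.countP p ≤ l'.countP p + 1 ∧ l'.countP p ≤ l.countP p + 1

lemma CountClose.symm {l l' : List X} (h : CountClose l l') : CountClose l' l :=
  ⟨h.1.symm, fun p => (h.2 p).symm⟩

variable [LinearOrder X]

/-- The rank interval of `x` in `l` comes within `r` of `⌈q |l|⌉`. -/
def RankErrorLE (q r : ℝ) (l : List X) (x : X) : Prop :=
  (rMin l x : ℝ) ≤ (⌈q * (l.length : ℝ)⌉₊ : ℝ) + r ∧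
    (⌈q * (l.length : ℝ)⌉₊ : ℝ) ≤ (rMax l x : ℝ) + r

lemma RankErrorLE.mono {q r r' : ℝ} {l : List X} {x : X} (h : RankErrorLE q r l x) (hr : r ≤ r') :
    RankErrorLE q r' l x :=
  ⟨h.1.trans (by gcongr), h.2.trans (by gcongr)⟩

lemma RankErrorLE.isApproxQuantile {α q : ℝ} (hα : 0 ≤ α) {l : List X} {x : X}
    (h : RankErrorLE q (α * (l.length : ℝ)) l x) : IsApproxQuantile α q l x := by
  have h0 : 0 ≤ α * (l.length : ℝ) := by positivity
  have h1 : (rMin l x : ℝ) ≤ rMax l x := by exact_mod_cast rMin_le_rMax l x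
  refine ⟨max (rMin l x : ℝ) ((⌈q * (l.length : ℝ)⌉₊ : ℝ) - α * (l.length : ℝ)),
    ⟨le_max_left _ _, max_le h1 ?_⟩, ⟨le_max_right _ _, max_le h.1 ?_⟩⟩
  · linarith [h.2]
  · linarith

/-- Ranks and target `⌈q m⌉` all move upwards, each by at most the number of new items, so the
errors do not add up to twice that number. -/
lemma RankErrorLE.append {q r : ℝ} (hq : 0 ≤ q) (hq1 : q ≤ 1) {l : List X} {x : X}
    (h : RankErrorLE q r l x) (l' : List X) :
    RankErrorLE q (r + (l'.length : ℝ)) (l ++ l') x := by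
  have hmin : rMin (l ++ l') x ≤ rMin l x + l'.length := by
    unfold rMin
    rw [List.countP_append]
    exact Nat.add_le_add_left List.countP_le_length _
  have hmax : rMax l x ≤ rMax (l ++ l') x := by
    unfold rMax
    rw [List.countP_append]
    exact Nat.le_add_right _ _
  have hlow : ⌈q * (l.length : ℝ)⌉₊ ≤ ⌈q * ((l ++ l').length : ℝ)⌉₊ := by
    gcongr
    simp
  have hup : ⌈q * ((l ++ l').length : ℝ)⌉₊ ≤ ⌈q * (l.length : ℝ)⌉₊ + l'.length := by
    rw [Nat.ceil_le]
    push_cast [List.length_append]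
    have := Nat.le_ceil (q * (l.length : ℝ))
    have : q * (l'.length : ℝ) ≤ l'.length := mul_le_of_le_one_left (by positivity) hq1
    linarith
  have hmin' : (rMin (l ++ l') x : ℝ) ≤ rMin l x + l'.length := by exact_mod_cast hmin
  have hmax' : (rMax l x : ℝ) ≤ rMax (l ++ l') x := by exact_mod_cast hmax
  have hlow' : (⌈q * (l.length : ℝ)⌉₊ : ℝ) ≤ ⌈q * ((l ++ l').length : ℝ)⌉₊ := by
    exact_mod_cast hlow
  have hup' : (⌈q * ((l ++ l').length : ℝ)⌉₊ : ℝ) ≤ ⌈q * (l.length : ℝ)⌉₊ + l'.length := by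
    exact_mod_cast hup
  exact ⟨by linarith [h.1], by linarith [h.2]⟩

lemma IsSketch.real_bounds {a : ℝ} (ha : 0 ≤ a) {l : List X} {S : List (GKTuple X)}
    (h : IsSketch (⌊2 * a * (l.length : ℝ)⌋₊ + 1) l S) (x : X) :
    (rHatMin S x : ℝ) ≤ rMin l x ∧ (rMin l x : ℝ) ≤ rHatMin S x + 2 * a * (l.length : ℝ) ∧
      (rMax l x : ℝ) + 1 ≤ rHatMax l.length S x ∧
      (rHatMax l.length S x : ℝ) ≤ rMax l x + 2 * a * (l.length : ℝ) + 1 := by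
  have hB : (⌊2 * a * (l.length : ℝ)⌋₊ : ℝ) ≤ 2 * a * (l.length : ℝ) :=
    Nat.floor_le (by positivity)
  have h1 : (rHatMin S x : ℝ) ≤ rMin l x := by exact_mod_cast h.rHatMin_le x
  have h2 : (rMin l x : ℝ) ≤ rHatMin S x + ⌊2 * a * (l.length : ℝ)⌋₊ := by
    exact_mod_cast h.rMin_le x
  have h3 : (rMax l x : ℝ) + 1 ≤ rHatMax l.length S x := by exact_mod_cast h.rMax_lt x
  have h4 : (rHatMax l.length S x : ℝ) ≤ rMax l x + ⌊2 * a * (l.length : ℝ)⌋₊ + 1 := by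
    exact_mod_cast h.rHatMax_le x
  exact ⟨h1, by linarith, h3, by linarith⟩

/-- Sensitivity of the score. -/
lemma score_le_score_add {a : ℝ} (ha : 0 ≤ a) {l l' : List X} (hl : CountClose l l')
    {S S' : List (GKTuple X)} (h : IsSketch (⌊2 * a * (l.length : ℝ)⌋₊ + 1) l S)
    (h' : IsSketch (⌊2 * a * (l'.length : ℝ)⌋₊ + 1) l' S') (q : ℝ) (x : X) :
    score q l.length S x ≤ score q l.length S' x + (4 * a * (l.length : ℝ) + 2) := by
  obtain ⟨b1, b2, b3, b4⟩ := h.real_bounds ha x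
  obtain ⟨c1, c2, c3, c4⟩ := h'.real_bounds ha x
  rw [← hl.1] at c2 c3 c4
  have d1 : (rMin l' x : ℝ) ≤ rMin l x + 1 := by
    exact_mod_cast (hl.2 (fun y => decide (y < x))).2
  have d2 : (rMax l x : ℝ) ≤ rMax l' x + 1 := by
    exact_mod_cast (hl.2 (fun y => decide (y ≤ x))).1
  have hm : 0 ≤ 2 * a * (l.length : ℝ) := by positivity
  unfold score
  generalize (⌈q * (l.length : ℝ)⌉₊ : ℝ) = k
  rw [neg_le_iff_add_nonneg, ← sub_nonneg]
  have key : max 0 (max ((rHatMin S' x : ℝ) - k) (k - (rHatMax l.length S' x : ℝ))) ≤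
      max 0 (max ((rHatMin S x : ℝ) - k) (k - (rHatMax l.length S x : ℝ))) +
        (4 * a * (l.length : ℝ) + 2) := by
    have e0 := le_max_left 0 (max ((rHatMin S x : ℝ) - k) (k - (rHatMax l.length S x : ℝ)))
    have e1 := (le_max_left _ _).trans
      (le_max_right 0 (max ((rHatMin S x : ℝ) - k) (k - (rHatMax l.length S x : ℝ))))
    have e2 := (le_max_right _ _).trans
      (le_max_right 0 (max ((rHatMin S x : ℝ) - k) (k - (rHatMax l.length S x : ℝ))))
    -- Passing through the true ranks costs `2am + 1` on either side, which is half of the allowed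
    -- amount.
    refine max_le (by linarith) (max_le (by linarith) (by linarith))
  linarith

lemma expWeight_le {a e : ℝ} (ha : 0 ≤ a) (he : 0 ≤ e) {l l' : List X} (hl : CountClose l l')
    {S S' : List (GKTuple X)} (h : IsSketch (⌊2 * a * (l.length : ℝ)⌋₊ + 1) l S)
    (h' : IsSketch (⌊2 * a * (l'.length : ℝ)⌋₊ + 1) l' S') (q : ℝ) (x : X) :
    expWeight a e q l.length S x ≤
      ENNReal.ofReal (Real.exp (e / 2)) * expWeight a e q l.length S' x := by
  unfold expWeight
  rw [← ENNReal.ofReal_mul (Real.exp_nonneg _), ← Real.exp_add]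
  apply ENNReal.ofReal_le_ofReal
  apply Real.exp_le_exp.mpr
  have hD : 0 < 4 * a * (l.length : ℝ) + 2 := by positivity
  have := mul_le_mul_of_nonneg_left (score_le_score_add ha hl h h' q x)
    (show 0 ≤ e / (2 * (4 * a * (l.length : ℝ) + 2)) by positivity)
  rw [mul_add (e / _)] at this
  have h2 : e / (2 * (4 * a * (l.length : ℝ) + 2)) * (4 * a * (l.length : ℝ) + 2) = e / 2 := by
    field_simp
  linarith

variable [Fintype X] [Nonempty X]

/-- Privacy of one release. -/
lemma dpExpGK_le {a e : ℝ} (ha : 0 ≤ a) (he : 0 ≤ e) {l l' : List X} (hl : CountClose l l')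
    {S S' : List (GKTuple X)} (h : IsSketch (⌊2 * a * (l.length : ℝ)⌋₊ + 1) l S)
    (h' : IsSketch (⌊2 * a * (l'.length : ℝ)⌋₊ + 1) l' S') (q : ℝ) (x : X) :
    dpExpGK a e q l.length S x ≤
      ENNReal.ofReal (Real.exp e) * dpExpGK a e q l.length S' x := by
  unfold dpExpGK
  rw [PMF.normalize_apply, PMF.normalize_apply]
  set c := ENNReal.ofReal (Real.exp (e / 2)) with hc
  have hc0 : c ≠ 0 := by simp [hc, Real.exp_pos]
  have hct : c ≠ ⊤ := ENNReal.ofReal_ne_top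
  have hcc : ENNReal.ofReal (Real.exp e) = c * c := by
    rw [hc, ← ENNReal.ofReal_mul (Real.exp_nonneg _), ← Real.exp_add, add_halves]
  -- The weight costs one factor `exp (e/2)`; the normalizer costs the other, with the two streams
  -- exchanged.
  have hW : ∑' y, expWeight a e q l.length S' y ≤ c * ∑' y, expWeight a e q l.length S y := by
    rw [← ENNReal.tsum_mul_left]
    refine ENNReal.tsum_le_tsum fun y => ?_
    have := expWeight_le ha he hl.symm h' h q y
    rwa [← hl.1] at this
  have hWinv : (∑' y, expWeight a e q l.length S y)⁻¹ ≤
      c * (∑' y, expWeight a e q l.length S' y)⁻¹ := by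
    rw [← ENNReal.inv_le_inv, ENNReal.mul_inv (Or.inl hc0) (Or.inl hct)] at hW
    calc (∑' y, expWeight a e q l.length S y)⁻¹
        = c * (c⁻¹ * (∑' y, expWeight a e q l.length S y)⁻¹) := by
          rw [← mul_assoc, ENNReal.mul_inv_cancel hc0 hct, one_mul]
      _ ≤ _ := by gcongr
  calc _ ≤ (c * expWeight a e q l.length S' x) *
        (c * (∑' y, expWeight a e q l.length S' y)⁻¹) :=
        mul_le_mul' (expWeight_le ha he hl h h' q x) hWinv
    _ = _ := by rw [hcc]; ring

/-- Utility of the exponential mechanism when the optimal score is `0`. -/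
lemma dpExpGK_score_lt {a e : ℝ} {q : ℝ} {n : ℕ} {S : List (GKTuple X)}
    (hopt : ∃ x, score q n S x = 0) (E : ℝ) (hc : 0 ≤ e / (2 * (4 * a * (n : ℝ) + 2))) :
    (dpExpGK a e q n S).toOuterMeasure {x | score q n S x < -E} ≤
      ENNReal.ofReal
        ((Fintype.card X : ℝ) * Real.exp (-(e / (2 * (4 * a * (n : ℝ) + 2)) * E))) := by
  obtain ⟨x₀, hx₀⟩ := hopt
  -- An element of score `0` has weight `1`, so the normalizer is at least `1`.
  have hW : (∑' y, expWeight a e q n S y)⁻¹ ≤ 1 := by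
    rw [ENNReal.inv_le_one]
    refine le_trans ?_ (ENNReal.le_tsum x₀)
    simp [expWeight, hx₀]
  rw [PMF.toOuterMeasure_apply_fintype]
  calc _ ≤ ∑ _x : X, ENNReal.ofReal (Real.exp (-(e / (2 * (4 * a * (n : ℝ) + 2)) * E))) := by
        refine Finset.sum_le_sum fun x _ => ?_
        rw [Set.indicator_apply]
        split_ifs with hx
        · unfold dpExpGK
          rw [PMF.normalize_apply]
          refine (mul_le_of_le_one_right' hW).trans ?_
          unfold expWeight
          refine ENNReal.ofReal_le_ofReal (Real.exp_le_exp.mpr ?_)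
          rw [← mul_neg]
          exact mul_le_mul_of_nonneg_left (le_of_lt hx) hc
        · exact zero_le
    _ = _ := by
        rw [Finset.sum_const, Finset.card_univ, nsmul_eq_mul,
          ENNReal.ofReal_mul (Nat.cast_nonneg _), ENNReal.ofReal_natCast]

/-- Take the least `x` with `rMax x ≥ k`. Its predecessor `z` in the universe has `rMax z < k`, and
items below `x` are at most `z`. -/
lemma exists_rMin_le_le_rMax (l : List X) {k : ℕ} (hk : k ≤ l.length) :
    ∃ x, rMin l x ≤ k ∧ k ≤ rMax l x := by
  have hne : (Finset.univ.filter fun x : X => k ≤ rMax l x).Nonempty := by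
    refine ⟨Finset.univ.max' Finset.univ_nonempty, ?_⟩
    have : rMax l (Finset.univ.max' Finset.univ_nonempty) = l.length := by
      unfold rMax
      rw [List.countP_eq_length]
      intro y _
      simpa using Finset.le_max' _ y (Finset.mem_univ y)
    simpa [this] using hk
  obtain ⟨x, hx, hmin⟩ := Finset.exists_min_image _ id hne
  refine ⟨x, ?_, by simpa using hx⟩
  rcases (Finset.univ.filter fun z : X => z < x).eq_empty_or_nonempty with he | he
  · have : rMin l x = 0 := by
      unfold rMin
      rw [List.countP_eq_zero]
      intro y _ hy
      have : y ∈ (Finset.univ.filter fun z : X => z < x) := by simpa using hy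
      simp [he] at this
    omega
  · obtain ⟨z, hz, hmax⟩ := Finset.exists_max_image _ id he
    simp only [Finset.mem_filter, Finset.mem_univ, true_and, id] at hz hmax hmin
    have h1 : rMin l x ≤ rMax l z :=
      List.countP_mono_left fun y _ hy => by
        simp only [decide_eq_true_eq] at hy ⊢; exact hmax y hy
    by_contra hlt
    exact absurd (hmin z (by omega)) (not_le.mpr hz)

lemma IsSketch.exists_score_eq_zero {B : ℕ} {l : List X} {S : List (GKTuple X)}
    (h : IsSketch B l S) {q : ℝ} (hq1 : q ≤ 1) : ∃ x, score q l.length S x = 0 := by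
  have hk : ⌈q * (l.length : ℝ)⌉₊ ≤ l.length := by
    rw [Nat.ceil_le]
    exact mul_le_of_le_one_left (by positivity) hq1
  obtain ⟨x, hx1, hx2⟩ := exists_rMin_le_le_rMax l hk
  refine ⟨x, ?_⟩
  have h1 : (rHatMin S x : ℝ) ≤ ⌈q * (l.length : ℝ)⌉₊ := by
    exact_mod_cast (h.rHatMin_le x).trans hx1
  have h2 : (⌈q * (l.length : ℝ)⌉₊ : ℝ) ≤ rHatMax l.length S x := by
    have := h.rMax_lt x
    exact_mod_cast hx2.trans (by omega)
  unfold score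
  rw [max_eq_left (max_le (by linarith) (by linarith)), neg_zero]

/-- Accuracy of one release. -/
lemma dpExpGK_accuracy {a e q : ℝ} (ha : 0 ≤ a) (he : 0 ≤ e) (hq1 : q ≤ 1) {l : List X}
    {S : List (GKTuple X)} (h : IsSketch (⌊2 * a * (l.length : ℝ)⌋₊ + 1) l S) (E : ℝ) :
    (dpExpGK a e q l.length S).toOuterMeasure
        {x | ¬ RankErrorLE q (E + 2 * a * (l.length : ℝ) + 1) l x} ≤
      ENNReal.ofReal ((Fintype.card X : ℝ) *
        Real.exp (-(e / (2 * (4 * a * (l.length : ℝ) + 2)) * E))) := by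
  refine le_trans (MeasureTheory.OuterMeasure.mono _ ?_)
    (dpExpGK_score_lt (h.exists_score_eq_zero hq1) E (by positivity))
  intro x hx
  by_contra hlt
  apply hx
  simp only [Set.mem_ofPred_eq, not_lt, score] at hlt
  have hlt' := neg_le_neg_iff.mp hlt
  have h1 := (le_max_left _ _).trans ((le_max_right _ _).trans hlt')
  have h2 := (le_max_right _ _).trans ((le_max_right _ _).trans hlt')
  obtain ⟨b1, b2, b3, b4⟩ := h.real_bounds ha x
  exact ⟨by linarith, by linarith⟩

end ExpMech

/-! ### Release times -/

section Releases

/-- Number of releases at the `k` positions after `s`. -/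
noncomputable def releasesIn (m α : ℝ) (s k : ℕ) : ℕ :=
  ((Finset.Ioc s (s + k)).filter (fun t => t = ⌈cp m α (t - 1)⌉₊)).card

lemma releasesIn_zero (m α : ℝ) (s : ℕ) : releasesIn m α s 0 = 0 := by simp [releasesIn]

lemma releasesIn_succ (m α : ℝ) (s k : ℕ) :
    releasesIn m α s (k + 1) =
      (if s + 1 = ⌈cp m α s⌉₊ then 1 else 0) + releasesIn m α (s + 1) k := by
  have h : Finset.Ioc s (s + (k + 1)) = insert (s + 1) (Finset.Ioc (s + 1) (s + 1 + k)) := by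
    ext t
    simp only [Finset.mem_Ioc, Finset.mem_insert]
    omega
  unfold releasesIn
  rw [h, Finset.filter_insert]
  simp only [Nat.add_sub_cancel]
  split_ifs
  · rw [Finset.card_insert_of_notMem (by simp), add_comm]
  · rw [zero_add]

lemma releaseTimes_card (m α : ℝ) (n : ℕ) :
    (releaseTimes m α n).card = releasesIn m α 0 n := by
  unfold releaseTimes releasesIn
  rw [zero_add]
  rfl

/-- The last release cannot precede its checkpoint, and all earlier releases have each multiplied
that checkpoint by `1 + α/2`. -/
lemma cp_mul_pow_le {m α : ℝ} (s k : ℕ) (h : releasesIn m α s k ≠ 0) :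
    cp m α s * (1 + α / 2) ^ (releasesIn m α s k - 1) ≤ ((s + k : ℕ) : ℝ) := by
  induction k generalizing s with
  | zero => simp [releasesIn_zero] at h
  | succ k ih =>
    have ih := ih (s + 1)
    rw [releasesIn_succ] at h ⊢
    rw [show s + 1 + k = s + (k + 1) by ring, cp] at ih
    split_ifs at ih h ⊢ with hs
    · rcases Nat.eq_zero_or_pos (releasesIn m α (s + 1) k) with h0 | h0
      · rw [h0]
        have h1 : cp m α s ≤ ((s + 1 : ℕ) : ℝ) := Nat.ceil_le.mp hs.ge
        have h2 : ((s + 1 : ℕ) : ℝ) ≤ ((s + (k + 1) : ℕ) : ℝ) := by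
          exact_mod_cast (by omega : s + 1 ≤ s + (k + 1))
        simpa using h1.trans h2
      · have := ih h0.ne'
        obtain ⟨j, hj⟩ := Nat.exists_eq_add_of_lt h0
        rw [hj] at this ⊢
        simp only [zero_add, Nat.add_sub_cancel, Nat.add_sub_cancel_left] at this ⊢
        rwa [pow_succ', ← mul_assoc]
    · simpa using ih (by simpa using h)

/-- A release at `s + 1` forces `cp s > s ≥ 1`, so the bound is free of `m`, which may be
arbitrarily small. -/
lemma pow_releasesIn_le {m α : ℝ} (hα : 0 ≤ α) {s : ℕ} (hs : 1 ≤ s) (k : ℕ) :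
    (1 + α / 2) ^ (releasesIn m α s k - 1) ≤ ((s + k : ℕ) : ℝ) := by
  induction k generalizing s with
  | zero => simpa [releasesIn_zero] using hs
  | succ k ih =>
    by_cases h : s + 1 = ⌈cp m α s⌉₊
    · have h1 : (s : ℝ) < cp m α s := Nat.lt_ceil.mp (by omega)
      have h2 : (1 : ℝ) ≤ s := by exact_mod_cast hs
      refine le_trans ?_ (cp_mul_pow_le s (k + 1) (by rw [releasesIn_succ, if_pos h]; omega))
      exact le_mul_of_one_le_left (by positivity) (by linarith)
    · rw [releasesIn_succ, if_neg h, zero_add, show s + (k + 1) = s + 1 + k by ring]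
      exact ih (by omega)

lemma log_ge_of_three_le {n : ℕ} (hn : 3 ≤ n) : 1.09 ≤ Real.log n := by
  have h3 : (3 : ℝ) ≤ n := by exact_mod_cast hn
  -- This gives `log 3 ≥ 2 - e/3 > 1.09`; a bound above `1` is needed in `le_log_card_mul`.
  have h := Real.one_sub_inv_le_log_of_pos (x := 3 / Real.exp 1) (by positivity)
  rw [Real.log_div (by norm_num) (Real.exp_ne_zero _), Real.log_exp, inv_div] at h
  have := Real.log_le_log (by norm_num) h3
  have := Real.exp_one_lt_d9
  linarith

/-- The constant is `5 = 1 + 1 + 3`: a possible release at position `1`, the first one after it, and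
`3 log n / α` others because `log (1 + α/2) ≥ α/3`. Each `1` is at most `log n / α`. -/
lemma releaseTimes_card_le (m : ℝ) {α : ℝ} (hα : 0 < α) (hα1 : α ≤ 1) {n : ℕ} (hn : 3 ≤ n) :
    ((releaseTimes m α n).card : ℝ) ≤ 5 * (Real.log n / α) := by
  obtain ⟨k, rfl⟩ : ∃ k, n = k + 1 := ⟨n - 1, by omega⟩
  have hlog := log_ge_of_three_le hn
  rw [releaseTimes_card, releasesIn_succ]
  have hpow := pow_releasesIn_le (m := m) hα.le le_rfl k
  have h1 : (releasesIn m α (0 + 1) k : ℝ) ≤ 1 + 3 * (Real.log (k + 1 : ℕ) / α) := by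
    have h2 := Real.log_le_log (by positivity) hpow
    rw [Real.log_pow, add_comm 1 k] at h2
    have h3 : α / 3 ≤ Real.log (1 + α / 2) := by
      refine le_trans ?_ (Real.one_sub_inv_le_log_of_pos (by positivity))
      rw [inv_eq_one_div, le_sub_iff_add_le, ← le_sub_iff_add_le', div_le_iff₀ (by positivity)]
      nlinarith
    have h4 : ((releasesIn m α 1 k - 1 : ℕ) : ℝ) * (α / 3) ≤ Real.log (k + 1 : ℕ) :=
      (mul_le_mul_of_nonneg_left h3 (Nat.cast_nonneg _)).trans h2
    have h5 : ((releasesIn m α 1 k - 1 : ℕ) : ℝ) ≤ 3 * (Real.log (k + 1 : ℕ) / α) := by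
      rw [← le_div_iff₀ (by positivity)] at h4
      refine h4.trans (le_of_eq ?_)
      field_simp
    have h6 : (releasesIn m α 1 k : ℝ) ≤ ((releasesIn m α 1 k - 1 : ℕ) : ℝ) + 1 := by
      exact_mod_cast (by omega : releasesIn m α 1 k ≤ (releasesIn m α 1 k - 1) + 1)
    rw [zero_add]
    linarith
  have h7 : 1 ≤ Real.log (k + 1 : ℕ) / α := by
    rw [one_le_div hα]; linarith
  push_cast [Nat.cast_ite] at h1 h7 ⊢
  split_ifs <;> linarith

lemma le_cp {m α : ℝ} (hm : 0 ≤ m) (hα : 0 ≤ α) (s : ℕ) : m ≤ cp m α s := by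
  induction s with
  | zero => exact le_rfl
  | succ s ih =>
    rw [cp]
    split_ifs
    · exact ih.trans (le_mul_of_one_le_right (hm.trans ih) (by linarith))
    · exact ih

end Releases

/-! ### Privacy -/

section Privacy

variable {X : Type*}

lemma countClose_set (l : List X) (i : ℕ) (a : X) : CountClose l (l.set i a) := by
  refine ⟨by simp, fun p => ?_⟩
  by_cases h : i < l.length
  · rw [List.countP_set h]
    have : (if p l[i] = true then 1 else 0) ≤ l.countP p := by
      split_ifs with hp
      · exact List.countP_pos_iff.mpr ⟨_, List.getElem_mem h, hp⟩
      · exact Nat.zero_le _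
    split_ifs at * <;> omega
  · rw [List.set_eq_of_length_le (by omega)]
    omega

lemma Neighbors.ofFn_eq_set {n : ℕ} {x y : Fin n → X} (h : Neighbors x y) :
    ∃ (i : ℕ) (a : X), List.ofFn y = (List.ofFn x).set i a := by
  obtain ⟨i, hi⟩ := h
  refine ⟨i, y i, List.ext_getElem (by simp) fun j h1 h2 => ?_⟩
  rw [List.getElem_set]
  split_ifs with hj
  · simp [← hj]
  · have := hi ⟨j, by simpa using h1⟩ (by rintro rfl; exact hj rfl)
    simp [this]

lemma Neighbors.countClose_take {n : ℕ} {x y : Fin n → X} (h : Neighbors x y) (s : ℕ) :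
    CountClose ((List.ofFn x).take s) ((List.ofFn y).take s) := by
  obtain ⟨i, a, hy⟩ := h.ofFn_eq_set
  rw [hy, List.take_set]
  exact countClose_set _ _ _

lemma take_drop_of_cons_eq_drop {L xs : List X} {x : X} {s : ℕ} (h : x :: xs = L.drop s) :
    (L.take s).length = s ∧ L.take (s + 1) = L.take s ++ [x] ∧ xs = L.drop (s + 1) ∧
      s < L.length := by
  have hlt : s < L.length := by
    by_contra hge
    rw [List.drop_of_length_le (by omega)] at h
    simp at h
  rw [List.drop_eq_getElem_cons hlt, List.cons.injEq] at h
  refine ⟨by simp; omega, ?_, h.2, hlt⟩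
  rw [List.take_succ_eq_append_getElem hlt, h.1]

/-- Adaptive composition for pure privacy: pointwise likelihood ratios multiply. -/
lemma pmf_bind_le {A B : Type*} {p p' : PMF A} {f f' : A → PMF B} {c d : ENNReal}
    (hp : ∀ x, p x ≤ c * p' x) (hf : ∀ x b, f x b ≤ d * f' x b) (b : B) :
    p.bind f b ≤ c * d * p'.bind f' b := by
  rw [PMF.bind_apply, PMF.bind_apply, ← ENNReal.tsum_mul_left]
  refine ENNReal.tsum_le_tsum fun x => ?_
  calc p x * f x b ≤ (c * p' x) * (d * f' x b) := mul_le_mul' (hp x) (hf x b)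
    _ = _ := by ring

lemma pmf_map_le {A B : Type*} {p p' : PMF A} {c : ENNReal} (g : A → B)
    (hp : ∀ x, p x ≤ c * p' x) (b : B) : p.map g b ≤ c * p'.map g b := by
  have := pmf_bind_le (f := PMF.pure ∘ g) (f' := PMF.pure ∘ g) (d := 1) hp
    (fun x b => by rw [one_mul]) b
  rwa [mul_one] at this

lemma pmf_toOuterMeasure_le {A : Type*} {p p' : PMF A} {c : ENNReal}
    (hp : ∀ x, p x ≤ c * p' x) (S : Set A) : p.toOuterMeasure S ≤ c * p'.toOuterMeasure S := by
  classical
  rw [PMF.toOuterMeasure_apply, PMF.toOuterMeasure_apply, ← ENNReal.tsum_mul_left]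
  refine ENNReal.tsum_le_tsum fun x => ?_
  rw [Set.indicator_apply, Set.indicator_apply]
  split_ifs
  · exact hp x
  · simp

variable [LinearOrder X]

lemma IsSketch.gkStep_take {a : ℝ} (ha : 0 ≤ a) {L xs : List X} {x : X} {s : ℕ}
    (hx : x :: xs = L.drop s) {S : List (GKTuple X)}
    (h : IsSketch (⌊2 * a * ((L.take s).length : ℝ)⌋₊ + 1) (L.take s) S) :
    IsSketch (⌊2 * a * ((L.take (s + 1)).length : ℝ)⌋₊ + 1) (L.take (s + 1))
      (DPQuantile.gkStep a s S x) := by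
  obtain ⟨h1, h2, -⟩ := take_drop_of_cons_eq_drop hx
  have := h.gkStep ha x
  rwa [h1, ← h2] at this

variable [Fintype X] [Nonempty X]

/-- The later outputs of the main loop on two close streams. -/
lemma coLoop_le (m α q : ℝ) {a e : ℝ} (ha : 0 ≤ a) (he : 0 ≤ e) {L L' : List X}
    (hL : ∀ s, CountClose (L.take s) (L'.take s)) (xs xs' : List X)
    (hlen : xs.length = xs'.length) (s : ℕ)
    (hxs : xs = L.drop s) (hxs' : xs' = L'.drop s) (S S' : List (GKTuple X))
    (hS : IsSketch (⌊2 * a * ((L.take s).length : ℝ)⌋₊ + 1) (L.take s) S)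
    (hS' : IsSketch (⌊2 * a * ((L'.take s).length : ℝ)⌋₊ + 1) (L'.take s) S')
    (v : Option X) (out : List (Option X)) :
    coLoop m α a e q xs s S v out ≤
      ENNReal.ofReal (Real.exp e) ^ releasesIn m α s xs.length *
        coLoop m α a e q xs' s S' v out := by
  induction xs generalizing xs' s S S' v out with
  | nil =>
    obtain rfl : xs' = [] := List.eq_nil_of_length_eq_zero (by simpa using hlen.symm)
    rw [coLoop, coLoop, List.length_nil, releasesIn_zero, pow_zero, one_mul]
  | cons x xs ih =>
    obtain ⟨x', xs', rfl⟩ : ∃ y ys, xs' = y :: ys := by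
      cases xs' with
      | nil => simp at hlen
      | cons y ys => exact ⟨y, ys, rfl⟩
    have hT := hS.gkStep_take ha hxs
    have hT' := hS'.gkStep_take ha hxs'
    have hd := (take_drop_of_cons_eq_drop hxs).2.2
    have hd' := (take_drop_of_cons_eq_drop hxs').2.2
    have ih' := fun v => ih xs' (by simpa using hlen) (s + 1) hd.1 hd'.1 _ _ hT hT' v
    rw [coLoop, coLoop, List.length_cons, releasesIn_succ]
    -- The test involves positions only, so both runs release together, and only releases cost a
    -- factor `exp e`.
    split_ifs with hc
    · rw [pow_add, pow_one]
      refine pmf_bind_le ?_ (fun y => pmf_map_le _ (ih' (some y))) out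
      intro y
      have hl : (L.take (s + 1)).length = s + 1 := by simp; omega
      have := dpExpGK_le ha he (hL (s + 1)) hT hT' q y
      rwa [hl] at this
    · rw [zero_add]
      exact pmf_map_le _ (ih' v) out

lemma continualQuantile_isDP {c b C α ε β q : ℝ} {n : ℕ}
    (he : 0 ≤ epsStar c n α ε)
    (ha : 0 ≤ sketchPrecision (Fintype.card X) (α / 2) (epsStar c n α ε) (betaStar b n α β))
    (hcard : ((releaseTimes (nMin C (Fintype.card X) n α ε β) α n).card : ℝ) *
      epsStar c n α ε ≤ ε) :
    IsDP ε 0 (fun x : Fin n → X => continualQuantile c b C α ε β q x) := by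
  intro x y hxy S
  rw [ENNReal.ofReal_zero, add_zero]
  refine pmf_toOuterMeasure_le (fun out => ?_) S
  unfold continualQuantile
  refine (coLoop_le _ α q ha he hxy.countClose_take _ (List.ofFn y) (by simp) 0 (by simp) (by simp)
    [] [] (IsSketch.nil _) (IsSketch.nil _) none out).trans ?_
  gcongr
  rw [List.length_ofFn, ← releaseTimes_card, ← ENNReal.ofReal_pow (Real.exp_nonneg _),
    ← Real.exp_nat_mul]
  exact ENNReal.ofReal_le_ofReal (Real.exp_le_exp.mpr hcard)

end Privacy

/-! ### Accuracy -/

section Accuracy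

lemma pmf_toOuterMeasure_le_one {A : Type*} (p : PMF A) (s : Set A) : p.toOuterMeasure s ≤ 1 :=
  (MeasureTheory.OuterMeasure.mono _ (Set.subset_univ s)).trans
    ((p.toOuterMeasure_apply_eq_one_iff Set.univ).mpr (Set.subset_univ _)).le

lemma pmf_bind_toOuterMeasure_le {A B : Type*} (p : PMF A) (f : A → PMF B) {bad : Set A}
    {s : Set B} {b c : ENNReal} (hp : p.toOuterMeasure bad ≤ b)
    (hf : ∀ y ∉ bad, (f y).toOuterMeasure s ≤ c) : (p.bind f).toOuterMeasure s ≤ b + c := by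
  classical
  rw [PMF.toOuterMeasure_bind_apply]
  calc ∑' y, p y * (f y).toOuterMeasure s ≤ ∑' y, (bad.indicator p y + p y * c) := by
        refine ENNReal.tsum_le_tsum fun y => ?_
        rw [Set.indicator_apply]
        split_ifs with hy
        · exact le_add_right (mul_le_of_le_one_right' (pmf_toOuterMeasure_le_one _ _))
        · rw [zero_add]
          exact mul_le_mul_right (hf y hy) _
    _ = p.toOuterMeasure bad + c := by
        rw [ENNReal.tsum_add, ENNReal.tsum_mul_right, p.tsum_coe, one_mul,
          PMF.toOuterMeasure_apply]
    _ ≤ b + c := by gcongr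

variable {X : Type*} [LinearOrder X]

/-- Outputs after position `s` that are wrong at some position from `m` on. -/
def wrongOutputs (m α q : ℝ) (L : List X) (s : ℕ) : Set (List (Option X)) :=
  {out | ∃ j, s + j < L.length ∧ m ≤ ((s + j + 1 : ℕ) : ℝ) ∧
    ¬ ∃ v : X, out[j]? = some (some v) ∧ IsApproxQuantile α q (L.take (s + j + 1)) v}

/-- The current value after position `s`: either there was no release yet, or the value was accurate
when it was released, and the next checkpoint is ahead. -/
def CurrentOK (m α q : ℝ) (L : List X) (s : ℕ) (v : Option X) : Prop :=
  (s : ℝ) < cp m α s ∧ (cp m α s = m ∨ ∃ t y, t ≤ s ∧ v = some y ∧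
    RankErrorLE q (α / 2 * (t : ℝ)) (L.take t) y ∧ cp m α s ≤ t * (1 + α / 2))

/-- Since `s < cp s ≤ t (1 + α/2)`, the error is at most `αt/2 + (s - t) ≤ αt ≤ αs`. The case
without a release is excluded by `s < cp s = m ≤ s`. -/
lemma CurrentOK.isApproxQuantile {m α q : ℝ} (hα : 0 ≤ α) (hq : 0 ≤ q) (hq1 : q ≤ 1) {L : List X}
    {s : ℕ} {v : Option X} (h : CurrentOK m α q L s v) (hs : s ≤ L.length) (hms : m ≤ s) :
    ∃ y, v = some y ∧ IsApproxQuantile α q (L.take s) y := by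
  obtain ⟨h1, h2 | ⟨t, y, hts, rfl, herr, hcp⟩⟩ := h
  · linarith
  · refine ⟨y, rfl, RankErrorLE.isApproxQuantile hα ?_⟩
    have hsplit : L.take s = L.take t ++ (L.drop t).take (s - t) := by
      rw [← List.take_add, Nat.add_sub_cancel' hts]
    have hlen : ((L.drop t).take (s - t)).length = s - t := by
      simp; omega
    have h3 := herr.append hq hq1 ((L.drop t).take (s - t))
    rw [← hsplit, hlen, Nat.cast_sub hts] at h3
    refine h3.mono ?_
    have hts' : (t : ℝ) ≤ s := by exact_mod_cast hts
    rw [List.length_take, min_eq_left hs]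
    nlinarith

lemma preimage_wrongOutputs_subset {m α q : ℝ} {L : List X} {s : ℕ} {v : Option X}
    (h : m ≤ ((s + 1 : ℕ) : ℝ) → ∃ y, v = some y ∧ IsApproxQuantile α q (L.take (s + 1)) y) :
    (fun out => v :: out) ⁻¹' wrongOutputs m α q L s ⊆ wrongOutputs m α q L (s + 1) := by
  rintro out ⟨j, hj, hm, hw⟩
  cases j with
  | zero =>
    obtain ⟨y, rfl, hy⟩ := h hm
    exact absurd ⟨y, rfl, hy⟩ hw
  | succ j =>
    have he : s + (j + 1) + 1 = s + 1 + j + 1 := by ring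
    rw [he] at hm hw
    exact ⟨j, by omega, hm, by simpa using hw⟩

variable [Fintype X] [Nonempty X]

/-- Union bound over releases with `CurrentOK` as loop invariant; a failed release costs `b` and
ends the analysis of that branch. -/
lemma coLoop_wrongOutputs_le {m α a e q : ℝ} (ha : 0 ≤ a) (hm : 0 < m) (hα : 0 < α)
    (hmα : 2 ≤ m * α) (hq : 0 ≤ q) (hq1 : q ≤ 1) (L : List X) (b : ENNReal)
    (hrel : ∀ l : List X, ∀ S, m ≤ (l.length : ℝ) →
      IsSketch (⌊2 * a * (l.length : ℝ)⌋₊ + 1) l S →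
      (dpExpGK a e q l.length S).toOuterMeasure
        {y | ¬ RankErrorLE q (α / 2 * (l.length : ℝ)) l y} ≤ b)
    (xs : List X) (s : ℕ) (hxs : xs = L.drop s) (hsL : s ≤ L.length) (S : List (GKTuple X))
    (hS : IsSketch (⌊2 * a * ((L.take s).length : ℝ)⌋₊ + 1) (L.take s) S)
    (v : Option X) (hv : CurrentOK m α q L s v) :
    (coLoop m α a e q xs s S v).toOuterMeasure (wrongOutputs m α q L s) ≤
      releasesIn m α s xs.length * b := by
  induction xs generalizing s S v with
  | nil =>
    have hle : L.length ≤ s := List.drop_eq_nil_iff.mp hxs.symm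
    have : wrongOutputs m α q L s = ∅ := by
      ext out
      simp only [wrongOutputs, Set.mem_ofPred_eq, Set.mem_empty_iff_false, iff_false]
      rintro ⟨j, hj, -⟩
      omega
    rw [this]
    simp
  | cons x xs ih =>
    have hT := hS.gkStep_take ha hxs
    obtain ⟨-, -, hd, hlt⟩ := take_drop_of_cons_eq_drop hxs
    have hl : (L.take (s + 1)).length = s + 1 := by simp; omega
    have hcur : ∀ w, CurrentOK m α q L (s + 1) w →
        ((coLoop m α a e q xs (s + 1) (gkStep a s S x) w).map
          (fun out => w :: out)).toOuterMeasure (wrongOutputs m α q L s) ≤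
          releasesIn m α (s + 1) xs.length * b := by
      intro w hw
      rw [PMF.toOuterMeasure_map_apply]
      refine (MeasureTheory.OuterMeasure.mono _ (preimage_wrongOutputs_subset fun hms =>
        hw.isApproxQuantile hα.le hq hq1 hlt hms)).trans ?_
      exact ih (s + 1) hd hlt _ hT w hw
    have hmcp := le_cp hm.le hα.le (m := m) (α := α) s
    have hscp : s + 1 ≤ ⌈cp m α s⌉₊ := Nat.lt_ceil.mpr hv.1
    rw [coLoop, List.length_cons, releasesIn_succ]
    split_ifs with hc
    · have hcs : cp m α s ≤ ((s + 1 : ℕ) : ℝ) := Nat.ceil_le.mp hc.ge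
      push_cast
      rw [add_mul, one_mul]
      refine pmf_bind_toOuterMeasure_le _ _
        (bad := {y | ¬ RankErrorLE q (α / 2 * ((s + 1 : ℕ) : ℝ)) (L.take (s + 1)) y}) ?_ ?_
      · have := hrel (L.take (s + 1)) _ (by rw [hl]; linarith) hT
        rwa [hl] at this
      · intro y hy
        refine hcur (some y) ⟨?_, Or.inr ⟨s + 1, y, le_rfl, rfl, not_not.mp hy, ?_⟩⟩
        -- By `hmα` the checkpoint advances by at least `1`, hence past `s + 1`. A checkpoint left
        -- behind would block all later releases, as the test is an equality.
        · rw [cp, if_pos hc]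
          push_cast
          nlinarith [hv.1]
        · rw [cp, if_pos hc]
          gcongr
    · rw [zero_add]
      refine hcur v ⟨?_, ?_⟩
      · rw [cp, if_neg hc]
        exact Nat.lt_ceil.mp (by omega)
      · rw [cp, if_neg hc]
        obtain ⟨-, h | ⟨t, y, h1, h2⟩⟩ := hv
        · exact Or.inl h
        · exact Or.inr ⟨t, y, h1.trans (Nat.le_succ s), h2⟩

/-- The relation of sketch precision, budget and data size that one accurate release needs. -/
lemma dpExpGK_not_rankErrorLE_le {α e L β' q : ℝ} (hα : 0 < α) (he : 0 < e) (he1 : e ≤ 1)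
    (hL : 1 ≤ L) (hβ : (Fintype.card X : ℝ) * Real.exp (-L) = β') (hq1 : q ≤ 1) {l : List X}
    (hlen : 4 * L / e + 1 ≤ α * (l.length : ℝ) / 4) {S : List (GKTuple X)}
    (hS : IsSketch (⌊2 * (α / 2 * e / (24 * L)) * (l.length : ℝ)⌋₊ + 1) l S) :
    (dpExpGK (α / 2 * e / (24 * L)) e q l.length S).toOuterMeasure
      {y | ¬ RankErrorLE q (α / 2 * (l.length : ℝ)) l y} ≤ ENNReal.ofReal β' := by
  have hL0 : 0 < L := by linarith
  set a := α / 2 * e / (24 * L) with ha_def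
  have ha : 0 ≤ a := by positivity
  set t : ℝ := (l.length : ℝ)
  have ht : 0 ≤ t := Nat.cast_nonneg _
  have hD : 0 < 4 * a * t + 2 := by positivity
  -- Chosen to make the exponent `-L`, so that the failure bound is exactly `β'`.
  set E := 2 * (4 * a * t + 2) / e * L with hE
  have hEe : e / (2 * (4 * a * t + 2)) * E = L := by
    rw [hE]; field_simp
  have h := dpExpGK_accuracy ha he.le hq1 hS E
  rw [show (l.length : ℝ) = t from rfl, hEe, hβ] at h
  refine le_trans (MeasureTheory.OuterMeasure.mono _ ?_) h
  intro y hy hy'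
  refine hy (hy'.mono ?_)
  -- With `hlen` the total error is at most `αt (1/6 + 1/24 + 1/4) = 11αt/24`, below `αt/2`.
  have h1 : E = α * t / 6 + 4 * L / e := by
    rw [hE, ha_def]; field_simp; ring
  have h2 : 2 * a * t ≤ α * t / 24 := by
    have h3 : e / L ≤ 1 := by rw [div_le_one hL0]; linarith
    have h4 : 2 * a * t = α * t / 24 * (e / L) := by rw [ha_def]; field_simp
    rw [h4]
    exact mul_le_of_le_one_right (by positivity) h3
  have h5 : 0 ≤ α * t := by positivity
  rw [h1]
  linarith

end Accuracy

/-! ### The choice of constants -/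

section Constants

variable {N n : ℕ} {α ε β : ℝ}

lemma card_div_betaStar (hN : 1 ≤ N) (hn : 3 ≤ n) (hα : 0 < α) (hβ : 0 < β) :
    Real.log ((N : ℝ) / betaStar (1 / 5) n α β) =
      Real.log 5 + Real.log ((N : ℝ) * Real.log n / (α * β)) := by
  have hℓ := log_ge_of_three_le hn
  have hN' : (1 : ℝ) ≤ N := by exact_mod_cast hN
  rw [← Real.log_mul (by norm_num) (by positivity)]
  congr 1
  unfold betaStar
  field_simp

lemma le_log_card_mul (hN : 1 ≤ N) (hn : 3 ≤ n) (hα : 0 < α) (hα1 : α ≤ 1) (hβ : 0 < β)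
    (hβ1 : β ≤ 1) : 0.08 ≤ Real.log ((N : ℝ) * Real.log n / (α * β)) := by
  have hℓ := log_ge_of_three_le hn
  have hN' : (1 : ℝ) ≤ N := by exact_mod_cast hN
  have h1 : (1.09 : ℝ) ≤ (N : ℝ) * Real.log n / (α * β) := by
    rw [le_div_iff₀ (by positivity)]
    have : α * β ≤ 1 := mul_le_one₀ hα1 hβ.le hβ1
    nlinarith
  refine le_trans ?_ (Real.log_le_log (by norm_num) h1)
  exact le_trans (by norm_num) (Real.one_sub_inv_le_log_of_pos (by norm_num))

lemma one_le_log_five : 1 ≤ Real.log 5 := by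
  rw [Real.le_log_iff_exp_le (by norm_num)]
  linarith [Real.exp_one_lt_d9]

lemma sketchPrecision_nonneg (hN : 1 ≤ N) (hn : 3 ≤ n) (hα : 0 < α) (hα1 : α ≤ 1) (hβ : 0 < β)
    (hβ1 : β ≤ 1) {e : ℝ} (he : 0 ≤ e) :
    0 ≤ sketchPrecision N (α / 2) e (betaStar (1 / 5) n α β) := by
  unfold sketchPrecision
  rw [card_div_betaStar hN hn hα hβ]
  have := le_log_card_mul hN hn hα hα1 hβ hβ1
  have := one_le_log_five
  have : 0 ≤ min e 1 := le_min he zero_le_one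
  positivity

/-- Put `Q = log n / (αε) ≥ 1`. As `Λ ≥ 0.08`, `log 5 ≤ 4 ≤ 50 Λ`, and the first claim reduces to
`1020 QΛ + 1 ≤ 2500 QℓΛ`, which holds because `ℓ ≥ 1` and `QΛ ≥ 0.08`. -/
lemma length_bound (hN : 1 ≤ N) (hn : 3 ≤ n) (hα : 0 < α) (hα1 : α ≤ 1) (hε : 0 < ε) (hβ : 0 < β)
    (hβ1 : β ≤ 1) (hαε : α * ε ≤ Real.log n) :
    4 * Real.log ((N : ℝ) / betaStar (1 / 5) n α β) / epsStar (1 / 5) n α ε + 1 ≤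
      α * nMin 10000 N n α ε β / 4 ∧ 2 ≤ nMin 10000 N n α ε β * α ∧
      0 < nMin 10000 N n α ε β := by
  have hℓ := log_ge_of_three_le hn
  have hΛ := le_log_card_mul hN hn hα hα1 hβ hβ1
  have h5 : Real.log 5 ≤ 4 := by
    have := Real.log_le_sub_one_of_pos (x := 5) (by norm_num)
    linarith
  rw [card_div_betaStar hN hn hα hβ]
  unfold epsStar nMin
  set Λ := Real.log ((N : ℝ) * Real.log n / (α * β))
  set ℓ := Real.log n
  have hQ1 : 1 ≤ ℓ / (α * ε) := by rwa [one_le_div (by positivity)]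
  have hm : α * (10000 * (1 / (ε * α ^ 2) * ℓ ^ 2 * Λ)) = 10000 * (ℓ / (α * ε)) * ℓ * Λ := by
    field_simp
  have hE : 4 * (Real.log 5 + Λ) / (1 / 5 * (α * ε / ℓ)) =
      20 * (ℓ / (α * ε)) * (Real.log 5 + Λ) := by
    field_simp; ring
  have hLΛ : Real.log 5 + Λ ≤ 51 * Λ := by linarith
  refine ⟨?_, ?_, by positivity⟩
  · rw [hm, hE]
    have h1 : 20 * (ℓ / (α * ε)) * (Real.log 5 + Λ) ≤ 20 * (ℓ / (α * ε)) * (51 * Λ) := by gcongr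
    have h2 : (ℓ / (α * ε)) * 1 * Λ ≤ (ℓ / (α * ε)) * ℓ * Λ := by gcongr; linarith
    have h3 : 1 * Λ ≤ (ℓ / (α * ε)) * Λ := by gcongr
    linarith
  · rw [mul_comm, hm]
    have h2 : (ℓ / (α * ε)) * 1 * Λ ≤ (ℓ / (α * ε)) * ℓ * Λ := by gcongr; linarith
    have h3 : 1 * Λ ≤ (ℓ / (α * ε)) * Λ := by gcongr
    linarith

variable {X : Type*} [LinearOrder X] [Fintype X] [Nonempty X]

lemma continualQuantile_accuracy {q : ℝ} (hn : 3 ≤ n) (hα : 0 < α) (hα1 : α ≤ 1) (hε : 0 < ε)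
    (hq : 0 ≤ q) (hq1 : q ≤ 1) (hβ : 0 < β) (hβ1 : β ≤ 1) (hαε : α * ε ≤ Real.log n)
    (x : Fin n → X) :
    (continualQuantile (1 / 5) (1 / 5) 10000 α ε β q x).toOuterMeasure
      (wrongOutputs (nMin 10000 (Fintype.card X) n α ε β) α q (List.ofFn x) 0) ≤
        ENNReal.ofReal β := by
  have hN : 1 ≤ Fintype.card X := Fintype.card_pos
  have hℓ := log_ge_of_three_le hn
  obtain ⟨h1, h2, h3⟩ := length_bound hN hn hα hα1 hε hβ hβ1 hαε
  have hΛ := le_log_card_mul hN hn hα hα1 hβ hβ1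
  have h5 := one_le_log_five
  have he : 0 < epsStar (1 / 5) n α ε := by unfold epsStar; positivity
  -- The assumption `αε ≤ log n` removes the minimum from the sketch precision.
  have he1 : epsStar (1 / 5) n α ε ≤ 1 := by
    unfold epsStar
    have : α * ε / Real.log n ≤ 1 := by rwa [div_le_one (by linarith)]
    linarith
  have hb : 0 < betaStar (1 / 5) n α β := by unfold betaStar; positivity
  have hL : 1 ≤ Real.log ((Fintype.card X : ℝ) / betaStar (1 / 5) n α β) := by
    rw [card_div_betaStar hN hn hα hβ]; linarith
  have ha := sketchPrecision_nonneg hN hn hα hα1 hβ hβ1 he.le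
  unfold continualQuantile
  refine (coLoop_wrongOutputs_le ha h3 hα h2 hq hq1 (List.ofFn x)
    (ENNReal.ofReal (betaStar (1 / 5) n α β)) ?_ _ 0 (by simp) (Nat.zero_le _) []
    (IsSketch.nil _) none ⟨by simpa [cp] using h3, Or.inl rfl⟩).trans ?_
  · intro l S hl hS
    unfold sketchPrecision at hS ⊢
    rw [min_eq_left he1] at hS ⊢
    refine dpExpGK_not_rankErrorLE_le hα he he1 hL ?_ hq1 (h1.trans ?_) hS
    · rw [Real.exp_neg, Real.exp_log (by positivity), inv_div]
      field_simp
    · gcongr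
  · rw [List.length_ofFn, ← releaseTimes_card, ← ENNReal.ofReal_natCast,
      ← ENNReal.ofReal_mul (Nat.cast_nonneg _)]
    refine ENNReal.ofReal_le_ofReal ?_
    refine (mul_le_mul_of_nonneg_right (releaseTimes_card_le _ hα hα1 hn) hb.le).trans
      (le_of_eq ?_)
    unfold betaStar
    field_simp

end Constants

end DPQuantile

/-! ### Assembly of privacy, release count and accuracy -/

theorem mainTheorem2 :
    ∃ c b C K : ℝ, 0 < c ∧ 0 < b ∧ 0 < C ∧ 0 < K ∧
      ∀ (X : Type*) [LinearOrder X] [Fintype X] [Nonempty X] (n : ℕ) (α ε q β : ℝ),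
        3 ≤ n → 0 < α → α ≤ 1 → 0 < ε → 0 ≤ q → q ≤ 1 → 0 < β → β ≤ 1 →
          -- privacy
          DPQuantile.IsDP ε 0
            (fun x : Fin n → X => DPQuantile.continualQuantile c b C α ε β q x) ∧
          -- number of releases
          ((DPQuantile.releaseTimes
              (DPQuantile.nMin C (Fintype.card X) n α ε β) α n).card : ℝ)
            ≤ K * (Real.log n / α) ∧
          -- accuracy
          (α * ε ≤ Real.log n →
            ∀ x : Fin n → X,
              ENNReal.ofReal (1 - β) ≤
                (DPQuantile.continualQuantile c b C α ε β q x).toOuterMeasure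
                  {out | ∀ s : ℕ, 1 ≤ s → s ≤ n →
                    DPQuantile.nMin C (Fintype.card X) n α ε β ≤ (s : ℝ) →
                      ∃ v : X, out[s - 1]? = some (some v) ∧
                        DPQuantile.IsApproxQuantile α q ((List.ofFn x).take s) v}) := by
  -- `c` and `b` are `1/K`, so `K log n / α` releases use up exactly `ε` and `β`; `10000` comes from
  -- `length_bound`.
  refine ⟨1 / 5, 1 / 5, 10000, 5, by norm_num, by norm_num, by norm_num, by norm_num, ?_⟩
  intro X _ _ _ n α ε q β hn hα hα1 hε hq hq1 hβ hβ1
  have hℓ := DPQuantile.log_ge_of_three_le hn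
  have he : 0 ≤ DPQuantile.epsStar (1 / 5) n α ε := by
    unfold DPQuantile.epsStar; positivity
  have hcard := DPQuantile.releaseTimes_card_le
    (DPQuantile.nMin 10000 (Fintype.card X) n α ε β) hα hα1 hn
  refine ⟨DPQuantile.continualQuantile_isDP he
    (DPQuantile.sketchPrecision_nonneg Fintype.card_pos hn hα hα1 hβ hβ1 he) ?_, hcard, ?_⟩
  · refine (mul_le_mul_of_nonneg_right hcard he).trans (le_of_eq ?_)
    unfold DPQuantile.epsStar
    field_simp
  · intro hαε x
    have hw := DPQuantile.continualQuantile_accuracy hn hα hα1 hε hq hq1 hβ hβ1 hαε x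
    rw [ENNReal.ofReal_sub _ hβ.le, ENNReal.ofReal_one, tsub_le_iff_right]
    set P := DPQuantile.continualQuantile (1 / 5) (1 / 5) 10000 α ε β q x
    refine le_trans ?_ (add_le_add_right hw _)
    refine le_trans ?_ (MeasureTheory.measure_union_le _ _)
    -- The target event and `wrongOutputs` cover all outputs, so their union has mass one.
    refine ((P.toOuterMeasure_apply_eq_one_iff _).mpr ?_).ge
    intro out _
    by_cases hout : out ∈ DPQuantile.wrongOutputs
        (DPQuantile.nMin 10000 (Fintype.card X) n α ε β) α q (List.ofFn x) 0
    · exact Or.inr hout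
    · refine Or.inl fun s hs1 hsn hs => ?_
      by_contra hbad
      obtain ⟨j, rfl⟩ : ∃ j, s = j + 1 := ⟨s - 1, by omega⟩
      refine hout ⟨j, by simp; omega, by simpa using hs, ?_⟩
      simpa using hbad
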